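/- There is an absolute constant $C>0$ such that the following holds for all integers $n\ge 2$ and $k\ge 0$. Let $H=H_{n,k}\subset\{0,1\}^n\subset\mathbb{R}^n$ be the set of all $0/1$-vectors with exactly $k$ ones, and for $x\in\mathbb{R}^n$ let $A_H(x)=(\operatorname{sign}\langle x,h\rangle)_{h\in H}\in\{-,0,+\}^H$. A linear decision tree is a ternary tree in which each inner node is labelled by a vector $q\in\mathbb{R}^n$ and has one child for each possible value of $\operatorname{sign}\langle q,x\rangle\in\{-,0,+\}$, and in which each leaf carries an output; its depth is the maximal number of queries on a path from the root to a leaf. Then there is a linear decision tree $T$ of depth at most $C\,k\,n\log^2 n$ such that: 1. $T$ is a comparison decision tree for $H$: each query $q$ of $T$ is either an element of $H$ (a query for the sign of $\sum_{i\in I}x_i$ with $|I|=k$) or a difference $h'-h''$ with $h',h''\in H$ (a comparison of $\sum_{i\in I}x_i$ with $\sum_{j\in J}x_j$, where $|I|=|J|=k$); 2. on every input $x\in\mathbb{R}^n$ the tree $T$ outputs $A_H(x)$; in particular it solves the $k$-SUM problem: there is a set $I\subseteq\{1,\dots,n\}$ with $|I|=k$ and $\sum_{i\in I}x_i=0$ if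 and only if the output of $T$ on $x$ has a $0$ entry; 3. each query of $T$ is $2k$-sparse (it has at most $2k$ nonzero coefficients) and all its coefficients lie in $\{-1,0,1\}$. -/

import Mathlib

noncomputable section

/-- A ternary linear decision tree for inputs `x ∈ ℝⁿ`, with outputs in `α` at the leaves.  An inner
node `query q child` asks for `sign ⟨q, x⟩` and continues with the subtree `child s`, where
`s ∈ {-1, 0, 1}` is the answer. -/
inductive LinearDecisionTree (n : ℕ) (α : Type*) where
  | leaf (a : α) : LinearDecisionTree n α
  | query (q : Fin n → ℝ) (child : SignType → LinearDecisionTree n α) : LinearDecisionTree n α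

namespace LinearDecisionTree

variable {n : ℕ} {α : Type*}

/-- The output of the tree on input `x`. -/
def eval (x : Fin n → ℝ) : LinearDecisionTree n α → α
  | leaf a => a
  | query q child => (child (SignType.sign (q ⬝ᵥ x))).eval x

/-- The depth of the tree: the largest number of queries on a path from the root to a leaf. -/
def depth : LinearDecisionTree n α → ℕ
  | leaf _ => 0
  | query _ child => (Finset.univ.sup fun s : SignType => (child s).depth) + 1

/-- The set of all queries at the inner nodes of the tree. -/
def queries : LinearDecisionTree n α → Set (Fin n → ℝ)
  | leaf _ => ∅
  | query q child => {q} ∪ ⋃ s : SignType, (child s).queries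

/-- A comparison decision tree for `H`: every query is a label query `sign ⟨h, x⟩` with `h ∈ H`
or a comparison query `sign ⟨h' - h'', x⟩` with `h', h'' ∈ H`. -/
def IsComparisonTree (H : Set (Fin n → ℝ)) (T : LinearDecisionTree n α) : Prop :=
  ∀ q ∈ T.queries, q ∈ H ∨ ∃ h' ∈ H, ∃ h'' ∈ H, q = h' - h''

/-- Every query of the tree has at most `s` nonzero coefficients. -/
def IsSparse (s : ℕ) (T : LinearDecisionTree n α) : Prop :=
  ∀ q ∈ T.queries, hammingNorm q ≤ s

end LinearDecisionTree

/-- The point-location function `A_H(x) = (sign ⟨x, h⟩ : h ∈ H) ∈ {-, 0, +}^H`. -/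
def pointLocation {n : ℕ} (H : Set (Fin n → ℝ)) (x : Fin n → ℝ) : H → SignType :=
  fun h => SignType.sign (x ⬝ᵥ (h : Fin n → ℝ))

/-- The vectors in `{0,1}ⁿ` of Hamming weight `k`. -/
def weightVectors (n k : ℕ) : Set (Fin n → ℝ) :=
  {h | (∀ i, h i = 0 ∨ h i = 1) ∧ hammingNorm h = k}

/-- `x` is a yes-instance of `k`-SUM: some `k` entries of `x`, at distinct positions,
have sum `0`. -/
def HasKSum {n : ℕ} (k : ℕ) (x : Fin n → ℝ) : Prop :=
  ∃ I : Finset (Fin n), I.card = k ∧ ∑ i ∈ I, x i = 0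

end

/-! A set `S` infers `h` at `x` when the labels and comparisons on `S` force the sign of `h` there.
Everything rests on the inference dimension of `0/1`-vectors being `O(n log n)`. If `(2d+1)^n <
2^d`, sort `d + 1` vectors of one sign class by their value at `x`. By pigeonhole, two sets of
consecutive differences have equal sums, and this writes some vector as the first one plus a
nonnegative combination of earlier differences (`exists_infers_of_monotone`). Hence at every `x` and
in every `S`, at most `3d` members are not inferred by the others (`card_filter_not_infers_le`).

The tree grows a sorted set `S` inside the set `K` of vectors whose sign is still unknown, until
half of `K` is inferred. For fixed `x`, double counting shows that sequences of `m` vectors, none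
inferred by its predecessors, are rare among all `|K|^m` sequences once `m` is a large multiple of
the dimension (`extensionCount_empty_le`).

Instead of sampling randomly, the argument uses conditional expectations. The inputs are replaced by
a finite set `X` representing all sign patterns (`exists_finset_representatives`), and each step
inserts the vector minimizing the number of bad continuations summed over `X`. After `m` steps
either half of `K` was inferred, or `X` has shrunk by a factor `2^m` (`solvable_of_extension`,
`solvable_of_card_lt`). Insertions use weighted binary search, paid for by the decrease of `log |X|`
(`solvable_of_insert`). With dimension `O(n log n)`, `log |H| = O(k log n)` and `log |X| = O(n log
|H|)`, the total depth is `O(k n log² n)`. -/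

noncomputable section
namespace LinearDecisionTree
open scoped Classical

variable {n : ℕ}

/-! ### Inference and insertion by weighted binary search -/

/-- The points `x` and `y` have the same signs and comparisons on `S`. -/
def SameOrder (S : Finset (Fin n → ℝ)) (x y : Fin n → ℝ) : Prop :=
  -- Adjoining `0` turns label queries into comparisons with `0`.
  ∀ s ∈ insert 0 S, ∀ t ∈ insert 0 S,
    SignType.sign ((s - t) ⬝ᵥ x) = SignType.sign ((s - t) ⬝ᵥ y)

/-- The label and comparison queries on `S` at `x` determine the sign of `h` at `x`. -/
def Infers (S : Finset (Fin n → ℝ)) (x h : Fin n → ℝ) : Prop :=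
  ∀ y, SameOrder S x y → SignType.sign (h ⬝ᵥ y) = SignType.sign (h ⬝ᵥ x)

/-- Some comparison tree for `H` of depth at most `D` locates all points of `X`. -/
def Solvable (H : Set (Fin n → ℝ)) (X : Finset (Fin n → ℝ)) (D : ℝ) : Prop :=
  ∃ T : LinearDecisionTree n (H → SignType), T.IsComparisonTree H ∧ (T.depth : ℝ) ≤ D ∧
    ∀ x ∈ X, T.eval x = pointLocation H x

lemma SameOrder.symm {S : Finset (Fin n → ℝ)} {x y : Fin n → ℝ} (h : SameOrder S x y) :
    SameOrder S y x := fun s hs t ht => (h s hs t ht).symm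

lemma SameOrder.trans {S : Finset (Fin n → ℝ)} {x y z : Fin n → ℝ} (h : SameOrder S x y)
    (h' : SameOrder S y z) : SameOrder S x z :=
  fun s hs t ht => (h s hs t ht).trans (h' s hs t ht)

lemma SameOrder.mono {S S' : Finset (Fin n → ℝ)} {x y : Fin n → ℝ} (hS : S ⊆ S')
    (h : SameOrder S' x y) : SameOrder S x y :=
  fun s hs t ht => h s (Finset.insert_subset_insert _ hS hs) t (Finset.insert_subset_insert _ hS ht)

lemma SameOrder.sign_eq {S : Finset (Fin n → ℝ)} {x y s : Fin n → ℝ} (h : SameOrder S x y)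
    (hs : s ∈ S) : SignType.sign (s ⬝ᵥ x) = SignType.sign (s ⬝ᵥ y) := by
  simpa using h s (Finset.mem_insert_of_mem hs) 0 (Finset.mem_insert_self _ _)

lemma SameOrder.neg {S : Finset (Fin n → ℝ)} {x y : Fin n → ℝ} (h : SameOrder S x y) :
    SameOrder S (-x) (-y) := fun s hs t ht => by
  rw [dotProduct_neg, dotProduct_neg, Left.sign_neg, Left.sign_neg, h s hs t ht]

lemma Infers.congr {S : Finset (Fin n → ℝ)} {x y h : Fin n → ℝ} (hxy : SameOrder S x y)
    (hi : Infers S x h) : Infers S y h := fun z hz =>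
  (hi z (hxy.trans hz)).trans (hi y hxy).symm

lemma Infers.mono {S S' : Finset (Fin n → ℝ)} {x h : Fin n → ℝ} (hS : S ⊆ S')
    (hi : Infers S x h) : Infers S' x h := fun z hz => hi z (hz.mono hS)

lemma infers_of_mem {S : Finset (Fin n → ℝ)} {x h : Fin n → ℝ} (hh : h ∈ S) : Infers S x h :=
  fun _ hy => (hy.sign_eq hh).symm

lemma Infers.of_neg {S : Finset (Fin n → ℝ)} {x h : Fin n → ℝ} (hi : Infers S (-x) h) :
    Infers S x h := fun y hy => by
  have := hi (-y) hy.neg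
  rw [dotProduct_neg, dotProduct_neg, Left.sign_neg, Left.sign_neg] at this
  exact neg_injective this

lemma Solvable.mono {H : Set (Fin n → ℝ)} {X : Finset (Fin n → ℝ)} {D D' : ℝ}
    (h : Solvable H X D) (hD : D ≤ D') : Solvable H X D' := by
  obtain ⟨T, h1, h2, h3⟩ := h
  exact ⟨T, h1, h2.trans hD, h3⟩

lemma solvable_of_forall_eq {H : Set (Fin n → ℝ)} {X : Finset (Fin n → ℝ)} {D : ℝ} (hD : 0 ≤ D)
    (h : ∀ x ∈ X, ∀ y ∈ X, pointLocation H x = pointLocation H y) : Solvable H X D := by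
  rcases X.eq_empty_or_nonempty with rfl | ⟨x₀, hx₀⟩
  · exact ⟨leaf 0, by simp [IsComparisonTree, queries], by simpa [depth], by simp⟩
  · exact ⟨leaf (pointLocation H x₀), by simp [IsComparisonTree, queries], by simpa [depth],
      fun x hx => h x₀ hx₀ x hx⟩

lemma solvable_query {H : Set (Fin n → ℝ)} {X : Finset (Fin n → ℝ)} {D : ℝ} (q : Fin n → ℝ)
    (hq : q ∈ H ∨ ∃ h' ∈ H, ∃ h'' ∈ H, q = h' - h'')
    (h : ∀ s, Solvable H (X.filter fun x => SignType.sign (q ⬝ᵥ x) = s) D) :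
    Solvable H X (D + 1) := by
  choose T h1 h2 h3 using h
  refine ⟨query q T, ?_, ?_, fun x hx => ?_⟩
  · intro p hp
    simp only [queries, Set.singleton_union, Set.mem_insert_iff, Set.mem_iUnion] at hp
    rcases hp with rfl | ⟨s, hs⟩
    · exact hq
    · exact h1 s p hs
  · obtain ⟨s, -, hs⟩ := Finset.exists_mem_eq_sup Finset.univ Finset.univ_nonempty
      (fun s : SignType => (T s).depth)
    simp only [depth, hs, Nat.cast_add, Nat.cast_one]
    linarith [h2 s]
  · exact h3 _ x (by simp [hx])

/-- Weighted binary search: inserting `u` into the sorted set `S` costs two queries plus twice the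
decrease of the logarithm of the number of points under consideration. -/
lemma solvable_of_insert {H : Set (Fin n → ℝ)} {S : Finset (Fin n → ℝ)} {u : Fin n → ℝ}
    (hu : u ∈ H) (hSH : ∀ s ∈ S, s ∈ H) {D : ℝ} (hD : 0 ≤ D) (X : Finset (Fin n → ℝ))
    (hX : X.Nonempty) (hord : ∀ x ∈ X, ∀ y ∈ X, SameOrder S x y)
    (hsol : ∀ X' ⊆ X, X'.Nonempty → (∀ x ∈ X', ∀ y ∈ X', SameOrder (insert u S) x y) →
      Solvable H X' (D + 2 * Real.logb 2 X'.card)) :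
    Solvable H X (D + 2 + 2 * Real.logb 2 X.card) := by
  induction hc : X.card using Nat.strong_induction_on generalizing X with
  | _ N ih =>
  subst hc
  have logmono : ∀ X' ⊆ X, X'.Nonempty → Real.logb 2 X'.card ≤ Real.logb 2 X.card := by
    intro X' h h'
    exact Real.logb_le_logb_of_le (by norm_num) (by exact_mod_cast h'.card_pos)
      (by exact_mod_cast Finset.card_le_card h)
  have lognn : 0 ≤ Real.logb 2 X.card :=
    Real.logb_nonneg (by norm_num) (by exact_mod_cast hX.card_pos)
  have hempty : Solvable H ∅ (D + 2 * Real.logb 2 X.card) :=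
    solvable_of_forall_eq (by linarith) (by simp)
  have final : ∀ X' ⊆ X, (∀ x ∈ X', ∀ y ∈ X', ∀ s ∈ insert 0 S,
      SignType.sign ((u - s) ⬝ᵥ x) = SignType.sign ((u - s) ⬝ᵥ y)) →
      Solvable H X' (D + 2 * Real.logb 2 X.card) := by
    intro X' hX' hs
    rcases X'.eq_empty_or_nonempty with rfl | hne
    · exact hempty
    refine (hsol X' hX' hne fun x hx y hy => ?_).mono (by linarith [logmono X' hX' hne])
    intro s hs' t ht'
    rw [Finset.insert_comm, Finset.mem_insert] at hs' ht'
    rcases hs' with rfl | hs' <;> rcases ht' with rfl | ht'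
    · simp
    · exact hs x hx y hy t ht'
    · rw [← neg_sub t s, neg_dotProduct, neg_dotProduct, Left.sign_neg, Left.sign_neg,
        hs x hx y hy s hs']
    · exact hord x (hX' hx) y (hX' hy) s hs' t ht'
  have half : ∀ X' ⊆ X, 2 * X'.card ≤ X.card → Solvable H X' (D + 2 * Real.logb 2 X.card) := by
    intro X' hX' hc
    rcases X'.eq_empty_or_nonempty with rfl | hne
    · exact hempty
    have hp := hne.card_pos
    refine (ih X'.card (by omega) X' hne (fun x hx y hy => hord x (hX' hx) y (hX' hy))
      (fun X'' h => hsol X'' (h.trans hX')) rfl).mono ?_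
    have h1 : Real.logb 2 (2 * X'.card) ≤ Real.logb 2 X.card :=
      Real.logb_le_logb_of_le (by norm_num) (by positivity) (by exact_mod_cast hc)
    rw [Real.logb_mul (by norm_num) (by positivity), Real.logb_self_eq_one (by norm_num)] at h1
    linarith
  have allowed : ∀ s ∈ insert 0 S, u - s ∈ H ∨ ∃ h' ∈ H, ∃ h'' ∈ H, u - s = h' - h'' := by
    intro s hs
    rcases Finset.mem_insert.1 hs with rfl | hs
    · left; simpa
    · right; exact ⟨u, hu, s, hSH s hs, rfl⟩
  obtain ⟨x₀, hx₀⟩ := hX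
  have hle : ∀ s ∈ insert 0 S, ∀ t ∈ insert 0 S, s ⬝ᵥ x₀ ≤ t ⬝ᵥ x₀ → ∀ x ∈ X,
      s ⬝ᵥ x ≤ t ⬝ᵥ x := by
    intro s hs t ht h x hx
    have := hord x₀ hx₀ x hx t ht s hs
    rw [sub_dotProduct, sub_dotProduct] at this
    have h1 : 0 ≤ SignType.sign (t ⬝ᵥ x₀ - s ⬝ᵥ x₀) := sign_nonneg_iff.2 (by linarith)
    rw [this, sign_nonneg_iff] at h1
    linarith
  -- `F` holds the thresholds with at most half of the points strictly below them in the order of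
  -- `u`-comparisons, and `G` the others. Querying `u` against the largest member of `F`, then if
  -- necessary against the smallest member of `G`, either fixes the position of `u` or leaves at
  -- most half of `X`.
  set F := (insert 0 S).filter fun s => 2 * (X.filter fun x => u ⬝ᵥ x < s ⬝ᵥ x).card ≤ X.card
    with hF
  set G := (insert 0 S).filter fun s => ¬ 2 * (X.filter fun x => u ⬝ᵥ x < s ⬝ᵥ x).card ≤ X.card
    with hG
  have second : ∀ X₂ ⊆ X, (∀ x ∈ X₂, ∀ s ∈ F, s ⬝ᵥ x < u ⬝ᵥ x) →
      Solvable H X₂ (D + 2 * Real.logb 2 X.card + 1) := by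
    intro X₂ hX₂ hlow
    rcases G.eq_empty_or_nonempty with hGe | hGn
    · refine (final X₂ hX₂ fun x hx y hy s hs => ?_).mono (by linarith)
      have hsF : s ∈ F := by
        by_contra hn
        have : s ∈ G := by
          simp only [hF, hG, Finset.mem_filter] at hn ⊢
          tauto
        simp [hGe] at this
      rw [sign_pos (by rw [sub_dotProduct]; linarith [hlow x hx s hsF]),
        sign_pos (by rw [sub_dotProduct]; linarith [hlow y hy s hsF])]
    · obtain ⟨t, htG, ht⟩ := G.exists_min_image (fun s => s ⬝ᵥ x₀) hGn
      obtain ⟨htS, htc⟩ := Finset.mem_filter.1 htG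
      refine solvable_query (u - t) (allowed t htS) fun σ => ?_
      by_cases hσ : σ = -1
      · refine final _ ((Finset.filter_subset _ _).trans hX₂) fun x hx y hy s hs => ?_
        by_cases hsF : s ∈ F
        · rw [sign_pos (by rw [sub_dotProduct]; linarith [hlow x (Finset.mem_filter.1 hx).1 s hsF]),
            sign_pos (by rw [sub_dotProduct]; linarith [hlow y (Finset.mem_filter.1 hy).1 s hsF])]
        · have hsG : s ∈ G := by
            simp only [hF, hG, Finset.mem_filter] at hsF ⊢
            tauto
          have key : ∀ z ∈ X₂.filter (fun x => SignType.sign ((u - t) ⬝ᵥ x) = σ),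
              SignType.sign ((u - s) ⬝ᵥ z) = -1 := by
            intro z hz
            obtain ⟨hz1, hz2⟩ := Finset.mem_filter.1 hz
            rw [hσ, sign_eq_neg_one_iff, sub_dotProduct] at hz2
            rw [sign_eq_neg_one_iff, sub_dotProduct]
            linarith [hle t htS s hs (ht s hsG) z (hX₂ hz1)]
          rw [key x hx, key y hy]
      · refine half _ ((Finset.filter_subset _ _).trans hX₂) ?_
        have hsub : X₂.filter (fun x => SignType.sign ((u - t) ⬝ᵥ x) = σ) ⊆
            X.filter fun x => ¬ u ⬝ᵥ x < t ⬝ᵥ x := by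
          intro z hz
          obtain ⟨hz1, hz2⟩ := Finset.mem_filter.1 hz
          refine Finset.mem_filter.2 ⟨hX₂ hz1, fun hlt => hσ ?_⟩
          rw [← hz2, sign_eq_neg_one_iff, sub_dotProduct]
          linarith
        have h1 := Finset.card_le_card hsub
        have h2 := Finset.card_filter_add_card_filter_not (s := X) (fun x => u ⬝ᵥ x < t ⬝ᵥ x)
        omega
  have hsum : D + 2 + 2 * Real.logb 2 X.card = D + 2 * Real.logb 2 X.card + 1 + 1 := by ring
  rw [hsum]
  rcases F.eq_empty_or_nonempty with hFe | hFn
  · exact (second X subset_rfl (by simp [hFe])).mono (by linarith)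
  · obtain ⟨t, htF, ht⟩ := F.exists_max_image (fun s => s ⬝ᵥ x₀) hFn
    obtain ⟨htS, htc⟩ := Finset.mem_filter.1 htF
    refine solvable_query (u - t) (allowed t htS) fun σ => ?_
    rcases σ.trichotomy with hσ | hσ | hσ
    · refine (half _ (Finset.filter_subset _ _) ?_).mono (by linarith)
      refine le_trans (Nat.mul_le_mul_left 2 (Finset.card_le_card fun z hz => ?_)) htc
      obtain ⟨hz1, hz2⟩ := Finset.mem_filter.1 hz
      rw [hσ, sign_eq_neg_one_iff, sub_dotProduct] at hz2
      exact Finset.mem_filter.2 ⟨hz1, by linarith⟩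
    · refine (final _ (Finset.filter_subset _ _) fun x hx y hy s hs => ?_).mono (by linarith)
      have key : ∀ z ∈ X.filter (fun x => SignType.sign ((u - t) ⬝ᵥ x) = σ),
          (u - s) ⬝ᵥ z = (t - s) ⬝ᵥ z := by
        intro z hz
        obtain ⟨hz1, hz2⟩ := Finset.mem_filter.1 hz
        rw [hσ, sign_eq_zero_iff, sub_dotProduct] at hz2
        rw [sub_dotProduct, sub_dotProduct]
        linarith
      rw [key x hx, key y hy]
      exact hord x (Finset.mem_filter.1 hx).1 y (Finset.mem_filter.1 hy).1 t htS s hs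
    · refine second _ (Finset.filter_subset _ _) fun x hx s hs => ?_
      obtain ⟨hx1, hx2⟩ := Finset.mem_filter.1 hx
      rw [hσ, sign_eq_one_iff, sub_dotProduct] at hx2
      linarith [hle s (Finset.mem_filter.1 hs).1 t htS (ht s hs) x hx1]

end LinearDecisionTree
end

/-! ### Inference dimension of `0/1`-vectors -/

noncomputable section
namespace LinearDecisionTree
open scoped Classical

variable {n : ℕ}

/-- In a long enough sequence of `0/1`-vectors, sorted by their values at `x` and all positive or
all zero at `x`, some vector is inferred from the preceding ones. -/
lemma exists_infers_of_monotone {d : ℕ} (hd : (2 * d + 1) ^ n < 2 ^ d) (h : ℕ → Fin n → ℝ)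
    (h01 : ∀ i ≤ d, ∀ j, h i j = 0 ∨ h i j = 1) (x : Fin n → ℝ)
    (hmono : ∀ i < d, h i ⬝ᵥ x ≤ h (i + 1) ⬝ᵥ x)
    (hcls : (∀ i ≤ d, 0 < h i ⬝ᵥ x) ∨ ∀ i ≤ d, h i ⬝ᵥ x = 0) :
    ∃ p < d, ∀ S : Finset (Fin n → ℝ), (∀ i ≤ p, h i ∈ S) → Infers S x (h (p + 1)) := by
  have hcoef : ∃ p < d, ∃ c : ℕ → ℝ, (∀ i, c i ≤ 1) ∧
      h (p + 1) - h p + ∑ i ∈ Finset.range p, c i • (h (i + 1) - h i) = 0 := by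
    let g : ℕ → Fin n → ℤ := fun i j => if h i j = 1 then 1 else 0
    have hg : ∀ i ≤ d, ∀ j, (g i j : ℝ) = h i j := by
      intro i hi j
      rcases h01 i hi j with e | e <;> simp [g, e]
    have hgd : ∀ i j, |g (i + 1) j - g i j| ≤ 1 := by
      intro i j
      simp only [g]
      split_ifs <;> simp
    let F : Finset ℕ → Fin n → ℤ := fun A j => ∑ i ∈ A, (g (i + 1) j - g i j)
    -- There are `2 ^ d` sets of differences. Each difference has entries in `{-1, 0, 1}`, so every
    -- sum lies in a box with `(2d+1)^n` integer points.
    obtain ⟨A, hA, B, hB, hne, hAB⟩ := Finset.exists_ne_map_eq_of_card_lt_of_maps_to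
      (s := (Finset.range d).powerset)
      (t := Fintype.piFinset fun _ : Fin n => Finset.Icc (-(d : ℤ)) d) (f := F) (by
        simp only [Fintype.card_piFinset, Int.card_Icc, Finset.prod_const, Finset.card_univ,
          Fintype.card_fin, Finset.card_powerset, Finset.card_range]
        convert hd using 2
        omega) (by
        intro A hA
        simp only [Finset.mem_coe, Finset.mem_powerset] at hA
        simp only [Finset.mem_coe, Fintype.mem_piFinset, Finset.mem_Icc, ← abs_le]
        intro j
        calc |F A j| ≤ ∑ i ∈ A, |g (i + 1) j - g i j| := Finset.abs_sum_le_sum_abs _ _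
          _ ≤ ∑ i ∈ A, 1 := Finset.sum_le_sum fun i _ => hgd i j
          _ ≤ d := by
            have := Finset.card_le_card hA
            simp only [Finset.card_range] at this
            simpa using this)
    have hAB' : ∀ j, ∑ i ∈ A, (h (i + 1) j - h i j) = ∑ i ∈ B, (h (i + 1) j - h i j) := by
      have key : ∀ A ∈ (Finset.range d).powerset, ∀ j,
          ((F A j : ℤ) : ℝ) = ∑ i ∈ A, (h (i + 1) j - h i j) := by
        intro A hA j
        simp only [F, Int.cast_sum, Int.cast_sub]
        refine Finset.sum_congr rfl fun i hi => ?_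
        have := Finset.mem_range.1 (Finset.mem_powerset.1 hA hi)
        rw [hg _ (by omega), hg _ (by omega)]
      intro j
      rw [← key A hA, ← key B hB, hAB]
    clear hAB
    rw [Finset.mem_powerset] at hA hB
    have hsd : (symmDiff A B).Nonempty := by
      rw [Finset.nonempty_iff_ne_empty]
      simpa [← Finset.bot_eq_empty] using hne
    -- Above the largest disagreement of `A` and `B` the relation has zero coefficients. Exchanging
    -- the two sets makes its coefficient at `p` equal to `1`.
    set p := (symmDiff A B).max' hsd with hp
    have hpm := (symmDiff A B).max'_mem hsd
    rw [← hp] at hpm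
    have hmax : ∀ i, p < i → (i ∈ A ↔ i ∈ B) := by
      intro i hi
      by_contra hc
      have : i ∈ symmDiff A B := by
        rw [Finset.mem_symmDiff]; tauto
      exact absurd ((symmDiff A B).le_max' i this) (by omega)
    clear_value p
    clear hp hsd hne
    wlog hpA : p ∈ A generalizing A B with H
    · refine H B hB A hA (fun j => (hAB' j).symm) ?_ (fun i hi => (hmax i hi).symm) ?_
      · rwa [symmDiff_comm]
      · rw [Finset.mem_symmDiff] at hpm; tauto
    have hpB : p ∉ B := by
      rw [Finset.mem_symmDiff] at hpm; tauto
    have hpd : p < d := Finset.mem_range.1 (hA hpA)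
    let c : ℕ → ℝ := fun i => (if i ∈ A then 1 else 0) - (if i ∈ B then 1 else 0)
    refine ⟨p, hpd, c, fun i => ?_, ?_⟩
    · simp only [c]; split_ifs <;> norm_num
    · have hcp : c p = 1 := by simp [c, hpA, hpB]
      have hz : ∑ i ∈ Finset.range d, c i • (h (i + 1) - h i) = 0 := by
        funext j
        simp only [Finset.sum_apply, Pi.smul_apply, Pi.sub_apply, smul_eq_mul, Pi.zero_apply, c,
          sub_mul, ite_mul, one_mul, zero_mul, Finset.sum_sub_distrib]
        rw [← Finset.sum_filter, ← Finset.sum_filter,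
          Finset.filter_mem_eq_inter, Finset.filter_mem_eq_inter,
          Finset.inter_eq_right.2 hA, Finset.inter_eq_right.2 hB]
        exact sub_eq_zero.2 (hAB' j)
      have hsub : Finset.range (p + 1) ⊆ Finset.range d := Finset.range_subset_range.2 hpd
      rw [← Finset.sum_subset hsub, Finset.sum_range_succ, hcp, one_smul, add_comm] at hz
      · exact hz
      · intro i _ hi
        have hi' : p < i := by simpa using hi
        have : c i = 0 := by simp [c, hmax i hi']
        rw [this, zero_smul]
  obtain ⟨p, hpd, c, hc, hrel⟩ := hcoef
  refine ⟨p, hpd, fun S hS y hy => ?_⟩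
  -- Telescoping `h p` and eliminating with the relation yields the weights `1 - c i`. Only `c i ≤
  -- 1` is needed to make them nonnegative.
  have hval : h (p + 1) ⬝ᵥ y = h 0 ⬝ᵥ y +
      ∑ i ∈ Finset.range p, (1 - c i) * ((h (i + 1) - h i) ⬝ᵥ y) := by
    have h1 := congrArg (fun v => v ⬝ᵥ y) hrel
    simp only [add_dotProduct, sum_dotProduct, smul_dotProduct, zero_dotProduct,
      smul_eq_mul] at h1
    have h2 := Finset.sum_range_sub (fun i => h i ⬝ᵥ y) p
    simp only [sub_mul, one_mul, Finset.sum_sub_distrib]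
    simp only [sub_dotProduct] at h1 h2 ⊢
    rw [Finset.sum_sub_distrib] at h2
    rw [Finset.sum_sub_distrib]
    linarith
  have hdiff : ∀ i < p, SignType.sign ((h (i + 1) - h i) ⬝ᵥ x) =
      SignType.sign ((h (i + 1) - h i) ⬝ᵥ y) := fun i hi =>
    hy _ (Finset.mem_insert_of_mem (hS (i + 1) (by omega))) _
      (Finset.mem_insert_of_mem (hS i (by omega)))
  have h0 := hy.sign_eq (hS 0 (by omega))
  rcases hcls with hpos | hzero
  · rw [sign_pos (hpos (p + 1) (by omega)), sign_eq_one_iff, hval]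
    rw [sign_pos (hpos 0 (by omega))] at h0
    refine add_pos_of_pos_of_nonneg (sign_eq_one_iff.1 h0.symm) (Finset.sum_nonneg fun i hi => ?_)
    rw [Finset.mem_range] at hi
    refine mul_nonneg (by linarith [hc i]) ?_
    rw [← sign_nonneg_iff, ← hdiff i hi, sign_nonneg_iff, sub_dotProduct]
    linarith [hmono i (by omega)]
  · rw [hzero (p + 1) (by omega), sign_zero, sign_eq_zero_iff, hval]
    rw [hzero 0 (by omega), sign_zero] at h0
    rw [sign_eq_zero_iff.1 h0.symm, zero_add]
    refine Finset.sum_eq_zero fun i hi => ?_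
    rw [Finset.mem_range] at hi
    have := hdiff i hi
    rw [sub_dotProduct, hzero _ (by omega), hzero _ (by omega), sub_zero, sign_zero] at this
    rw [sign_eq_zero_iff.1 this.symm, mul_zero]

/-- Any `d + 1` elements of a single sign class, sorted by value at `x`, would contain one inferred
by its predecessors, hence by `S` without it. -/
lemma card_le_of_forall_not_infers {d : ℕ} (hd : (2 * d + 1) ^ n < 2 ^ d)
    {S N : Finset (Fin n → ℝ)} (hNS : N ⊆ S) (h01 : ∀ h ∈ S, ∀ j, h j = 0 ∨ h j = 1)
    (x : Fin n → ℝ) (hN : ∀ h ∈ N, ¬ Infers (S.erase h) x h)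
    (hcls : (∀ h ∈ N, 0 < h ⬝ᵥ x) ∨ ∀ h ∈ N, h ⬝ᵥ x = 0) : N.card ≤ d := by
  by_contra! hlt
  obtain ⟨N', hN', hcard⟩ := Finset.exists_subset_card_eq (show d + 1 ≤ N.card from hlt)
  let e : Fin (d + 1) ≃ N' := (N'.equivFinOfCardEq hcard).symm
  let σ := Tuple.sort fun i => (e i : Fin n → ℝ) ⬝ᵥ x
  have hσ : Monotone fun i => (e (σ i) : Fin n → ℝ) ⬝ᵥ x :=
    Tuple.monotone_sort fun i => (e i : Fin n → ℝ) ⬝ᵥ x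
  let h : ℕ → Fin n → ℝ := fun i => if hi : i < d + 1 then e (σ ⟨i, hi⟩) else 0
  have hh : ∀ i (hi : i < d + 1), h i = e (σ ⟨i, hi⟩) := fun i hi => dif_pos hi
  have hmem : ∀ i ≤ d, h i ∈ N := fun i hi => by
    rw [hh i (by omega)]; exact hN' (e _).2
  obtain ⟨p, hp, hinf⟩ := exists_infers_of_monotone hd h
    (fun i hi => h01 _ (hNS (hmem i hi))) x
    (fun i hi => by
      rw [hh i (by omega), hh (i + 1) (by omega)]
      exact hσ (by simp))
    (hcls.imp (fun H i hi => H _ (hmem i hi)) fun H i hi => H _ (hmem i hi))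
  refine hN _ (hmem (p + 1) hp) (hinf _ fun i hi => Finset.mem_erase.2 ⟨?_, hNS (hmem i (by omega))⟩)
  rw [hh i (by omega), hh (p + 1) (by omega)]
  intro heq
  have := σ.injective (e.injective (Subtype.ext heq))
  simp only [Fin.mk.injEq] at this
  omega

/-- The inference dimension of the `0/1`-vectors. -/
lemma card_filter_not_infers_le {d : ℕ} (hd : (2 * d + 1) ^ n < 2 ^ d) {S : Finset (Fin n → ℝ)}
    (h01 : ∀ h ∈ S, ∀ j, h j = 0 ∨ h j = 1) (x : Fin n → ℝ) :
    (S.filter fun h => ¬ Infers (S.erase h) x h).card ≤ 3 * d := by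
  set N := S.filter fun h => ¬ Infers (S.erase h) x h with hN
  have hNS : N ⊆ S := Finset.filter_subset _ _
  have hNi : ∀ h ∈ N, ¬ Infers (S.erase h) x h := fun h hh => (Finset.mem_filter.1 hh).2
  have h1 : (N.filter fun h => 0 < h ⬝ᵥ x).card ≤ d :=
    card_le_of_forall_not_infers hd ((Finset.filter_subset _ _).trans hNS) h01 x
      (fun h hh => hNi h (Finset.mem_filter.1 hh).1)
      (Or.inl fun h hh => (Finset.mem_filter.1 hh).2)
  have h2 : (N.filter fun h => h ⬝ᵥ x = 0).card ≤ d :=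
    card_le_of_forall_not_infers hd ((Finset.filter_subset _ _).trans hNS) h01 x
      (fun h hh => hNi h (Finset.mem_filter.1 hh).1)
      (Or.inr fun h hh => (Finset.mem_filter.1 hh).2)
  -- Negative values become positive at `-x`, and inference is invariant under this reflection.
  have h3 : (N.filter fun h => h ⬝ᵥ x < 0).card ≤ d :=
    card_le_of_forall_not_infers hd ((Finset.filter_subset _ _).trans hNS) h01 (-x)
      (fun h hh hi => hNi h (Finset.mem_filter.1 hh).1 hi.of_neg)
      (Or.inl fun h hh => by
        rw [dotProduct_neg]; linarith [(Finset.mem_filter.1 hh).2])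
  have hsub : N ⊆ (N.filter fun h => 0 < h ⬝ᵥ x) ∪ (N.filter fun h => h ⬝ᵥ x = 0) ∪
      (N.filter fun h => h ⬝ᵥ x < 0) := by
    intro h hh
    simp only [Finset.mem_union, Finset.mem_filter, hh, true_and]
    rcases lt_trichotomy (h ⬝ᵥ x) 0 with a | a | a <;> tauto
  have := Finset.card_le_card hsub
  have := Finset.card_union_le ((N.filter fun h => 0 < h ⬝ᵥ x) ∪ (N.filter fun h => h ⬝ᵥ x = 0))
    (N.filter fun h => h ⬝ᵥ x < 0)
  have := Finset.card_union_le (N.filter fun h => 0 < h ⬝ᵥ x) (N.filter fun h => h ⬝ᵥ x = 0)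
  omega

/-! ### Counting sequences without inference -/

/-- The number of ways to extend `S` by `r` successive elements of `K`, none of which is inferred
at `x` from its predecessors. -/
def extensionCount (K : Finset (Fin n → ℝ)) (x : Fin n → ℝ) : ℕ → Finset (Fin n → ℝ) → ℕ
  | 0, _ => 1
  | r + 1, S => ∑ u ∈ K with ¬ Infers S x u, extensionCount K x r (insert u S)

/-- The number of orderings of `r` elements of `S` from the last one downwards, such that no element
is inferred at `x` from the remaining elements of `S`. -/
def orderingCount (x : Fin n → ℝ) : ℕ → Finset (Fin n → ℝ) → ℕ
  | 0, _ => 1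
  | r + 1, S => ∑ u ∈ S with ¬ Infers (S.erase u) x u, orderingCount x r (S.erase u)

lemma orderingCount_le {d : ℕ} {K : Finset (Fin n → ℝ)} {x : Fin n → ℝ}
    (hK : ∀ S ⊆ K, (S.filter fun h => ¬ Infers (S.erase h) x h).card ≤ d) (r : ℕ)
    {S : Finset (Fin n → ℝ)} (hS : S ⊆ K) : orderingCount x r S ≤ d ^ r := by
  induction r generalizing S with
  | zero => simp [orderingCount]
  | succ r ih =>
    rw [orderingCount, pow_succ']
    refine (Finset.sum_le_card_nsmul _ _ (d ^ r) fun u _ =>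
      ih ((Finset.erase_subset _ _).trans hS)).trans ?_
    rw [smul_eq_mul]
    exact Nat.mul_le_mul_right _ (hK S hS)

/-- Both sides count non-inferred sequences of length `j + r + 1`, cut after `j` or after `j + 1`
terms. The bijection moves the next element `u` into the initial set. -/
lemma sum_ordering_mul_extension_succ (K : Finset (Fin n → ℝ)) (x : Fin n → ℝ) (j r : ℕ) :
    ∑ S ∈ K.powersetCard j, orderingCount x j S * extensionCount K x (r + 1) S =
      ∑ S ∈ K.powersetCard (j + 1), orderingCount x (j + 1) S * extensionCount K x r S := by
  simp only [orderingCount, extensionCount, Finset.mul_sum, Finset.sum_mul]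
  rw [Finset.sum_sigma', Finset.sum_sigma']
  have hnot : ∀ {S : Finset (Fin n → ℝ)} {u}, ¬ Infers S x u → u ∉ S :=
    fun h hu => h (infers_of_mem hu)
  refine Finset.sum_bij' (fun a _ => ⟨insert a.2 a.1, a.2⟩) (fun a _ => ⟨a.1.erase a.2, a.2⟩)
    ?_ ?_ ?_ ?_ ?_
  · rintro ⟨S, u⟩ h
    simp only [Finset.mem_sigma, Finset.mem_powersetCard, Finset.mem_filter] at h ⊢
    obtain ⟨⟨h1, h2⟩, h3, h4⟩ := h
    refine ⟨⟨Finset.insert_subset h3 h1, ?_⟩, Finset.mem_insert_self _ _, ?_⟩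
    · rw [Finset.card_insert_of_notMem (hnot h4), h2]
    · rwa [Finset.erase_insert (hnot h4)]
  · rintro ⟨S, u⟩ h
    simp only [Finset.mem_sigma, Finset.mem_powersetCard, Finset.mem_filter] at h ⊢
    obtain ⟨⟨h1, h2⟩, h3, h4⟩ := h
    refine ⟨⟨(Finset.erase_subset _ _).trans h1, ?_⟩, h1 h3, h4⟩
    rw [Finset.card_erase_of_mem h3, h2]; rfl
  · rintro ⟨S, u⟩ h
    simp only [Finset.mem_sigma, Finset.mem_filter] at h
    simp [Finset.erase_insert (hnot h.2.2)]
  · rintro ⟨S, u⟩ h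
    simp only [Finset.mem_sigma, Finset.mem_filter] at h
    simp [Finset.insert_erase h.2.1]
  · rintro ⟨S, u⟩ h
    simp only [Finset.mem_sigma, Finset.mem_filter] at h
    simp [Finset.erase_insert (hnot h.2.2)]

/-- Shifting the cut to the end groups the sequences by their underlying `m`-sets. Peeling off
elements from the last one leaves at most `d` choices each time, so each set carries at most `d ^ m`
sequences. -/
lemma extensionCount_empty_le {d : ℕ} {K : Finset (Fin n → ℝ)} {x : Fin n → ℝ}
    (hK : ∀ S ⊆ K, (S.filter fun h => ¬ Infers (S.erase h) x h).card ≤ d) (m : ℕ) :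
    extensionCount K x m ∅ * m.factorial ≤ (K.card * d) ^ m := by
  have hshift : ∀ j ≤ m, extensionCount K x m ∅ =
      ∑ S ∈ K.powersetCard j, orderingCount x j S * extensionCount K x (m - j) S := by
    intro j
    induction j with
    | zero => simp [orderingCount]
    | succ j ih =>
      intro hj
      rw [ih (by omega), ← sum_ordering_mul_extension_succ, show m - j = m - (j + 1) + 1 by omega]
  have h1 : extensionCount K x m ∅ ≤ K.card.choose m * d ^ m := by
    rw [hshift m le_rfl, ← Finset.card_powersetCard, ← smul_eq_mul]
    refine Finset.sum_le_card_nsmul _ _ _ fun S hS => ?_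
    simpa [extensionCount] using orderingCount_le hK m (Finset.mem_powersetCard.1 hS).1
  calc extensionCount K x m ∅ * m.factorial
      ≤ K.card.choose m * d ^ m * m.factorial := Nat.mul_le_mul_right _ h1
    _ = m.factorial * K.card.choose m * d ^ m := by ring
    _ = K.card.descFactorial m * d ^ m := by rw [Nat.descFactorial_eq_factorial_mul_choose]
    _ ≤ K.card ^ m * d ^ m := Nat.mul_le_mul_right _ (Nat.descFactorial_le_pow _ _)
    _ = _ := (mul_pow _ _ _).symm

end LinearDecisionTree
end

/-! ### Sign patterns of linear forms -/

noncomputable section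
namespace LinearDecisionTree
open scoped Classical

/-- The sign patterns of `N` linear forms on a real vector space of dimension `r` number at most
`(2 N + 1) ^ r`. -/
lemma ncard_range_sign_le {V : Type*} [AddCommGroup V] [Module ℝ V] [FiniteDimensional ℝ V]
    {N : ℕ} (f : Fin N → Module.Dual ℝ V) :
    (Set.range fun (v : V) (i : Fin N) => SignType.sign (f i v)).ncard ≤
      (2 * N + 1) ^ Module.finrank ℝ V := by
  induction N generalizing V with
  | zero =>
    refine (Set.ncard_le_one (Set.toFinite _)).2 (fun a _ b _ => Subsingleton.elim a b) |>.trans ?_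
    simp
  | succ N ih =>
    set R := Set.range fun (v : V) (i : Fin (N + 1)) => SignType.sign (f i v) with hR
    set R₁ := Set.range fun (v : V) (i : Fin N) => SignType.sign (f i.succ v) with hR₁
    set R₀ := Set.range fun (v : LinearMap.ker (f 0)) (i : Fin N) =>
      SignType.sign (f i.succ v) with hR₀
    have h₁ : R₁.ncard ≤ (2 * N + 1) ^ Module.finrank ℝ V := ih fun i => f i.succ
    have h₀ : R₀.ncard ≤ (2 * N + 1) ^ Module.finrank ℝ (LinearMap.ker (f 0)) :=
      ih fun i => (f i.succ).domRestrict (LinearMap.ker (f 0))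
    by_cases hf : f 0 = 0
    · have : R.ncard ≤ R₁.ncard := by
        refine Set.ncard_le_ncard_of_injOn (fun a i => a i.succ) ?_ ?_ (Set.toFinite _)
        · rintro _ ⟨v, rfl⟩
          exact ⟨v, rfl⟩
        · rintro _ ⟨v, rfl⟩ _ ⟨w, rfl⟩ h
          funext i
          refine Fin.cases ?_ (fun j => congrFun h j) i
          simp [hf]
      exact (this.trans h₁).trans (Nat.pow_le_pow_left (by omega) _)
    -- A pattern of the remaining forms has at most three extensions by the sign of `f 0`, and more
    -- than one only if it is realized on the kernel of `f 0`.
    have hfib : R.ncard ≤ R₁.ncard + 2 * R₀.ncard := by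
      have hmem : ∀ s : SignType, ∀ a ∈ R, a 0 = s → ∀ b ∈ R, b 0 ≠ s →
          (fun i : Fin N => a i.succ) = (fun i : Fin N => b i.succ) →
          (fun i : Fin N => a i.succ) ∈ R₀ := by
        rintro s _ ⟨v, rfl⟩ hv _ ⟨w, rfl⟩ hw hvw
        dsimp only at hv hw hvw ⊢
        rcases eq_or_ne (f 0 v) 0 with h0 | h0
        · exact ⟨⟨v, h0⟩, rfl⟩
        rcases eq_or_ne (f 0 w) 0 with h0' | h0'
        · rw [hvw]; exact ⟨⟨w, h0'⟩, rfl⟩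
        have hneg : f 0 v * f 0 w < 0 := by
          rw [← hv] at hw
          rcases lt_or_gt_of_ne h0 with a | a <;> rcases lt_or_gt_of_ne h0' with b | b
          · rw [sign_neg a, sign_neg b] at hw; exact absurd rfl hw
          · exact mul_neg_of_neg_of_pos a b
          · exact mul_neg_of_pos_of_neg a b
          · rw [sign_pos a, sign_pos b] at hw; exact absurd rfl hw
        -- The segment from `v` to `w` crosses the kernel of `f 0`; up to scaling this is the
        -- crossing point, and a positive combination keeps the common signs of the other forms.
        refine ⟨⟨|f 0 w| • v + |f 0 v| • w, ?_⟩, ?_⟩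
        · rw [LinearMap.mem_ker, map_add, map_smul, map_smul, smul_eq_mul, smul_eq_mul]
          rcases lt_or_gt_of_ne h0 with a | a <;> rcases lt_or_gt_of_ne h0' with b | b
          · nlinarith
          · rw [abs_of_neg a, abs_of_pos b]; ring
          · rw [abs_of_pos a, abs_of_neg b]; ring
          · nlinarith
        · funext i
          have hi := congrFun hvw i
          change SignType.sign (f i.succ (|f 0 w| • v + |f 0 v| • w)) = SignType.sign (f i.succ v)
          rw [map_add, map_smul, map_smul, smul_eq_mul, smul_eq_mul]
          have p1 := abs_pos.2 h0
          have p2 := abs_pos.2 h0'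
          rcases lt_trichotomy (f i.succ v) 0 with a | a | a
          · rw [sign_neg a] at hi ⊢
            have b := sign_eq_neg_one_iff.1 hi.symm
            exact sign_neg (by nlinarith)
          · rw [a, sign_zero] at hi ⊢
            have b := sign_eq_zero_iff.1 hi.symm
            simp [b]
          · rw [sign_pos a] at hi ⊢
            have b := sign_eq_one_iff.1 hi.symm
            exact sign_pos (by nlinarith)
      let φ : R → R₁ ⊕ (Bool × R₀) := fun a =>
        if h : (fun i : Fin N => a.1 i.succ) ∈ R₀ ∧ a.1 0 ≠ 0 then
          Sum.inr (decide (a.1 0 = 1), ⟨_, h.1⟩)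
        else Sum.inl ⟨fun i => a.1 i.succ, by
          obtain ⟨v, hv⟩ := a.2
          exact ⟨v, by rw [← hv]⟩⟩
      have hφ : Function.Injective φ := by
        rintro ⟨a, ha⟩ ⟨b, hb⟩ hab
        have hsuff : a 0 = b 0 → (fun i : Fin N => a i.succ) = (fun i : Fin N => b i.succ) →
            (⟨a, ha⟩ : R) = ⟨b, hb⟩ := by
          intro h0 h
          refine Subtype.ext (funext fun i => Fin.cases h0 (fun j => congrFun h j) i)
        simp only [φ] at hab
        split_ifs at hab with h h' h'
        · simp only [Sum.inr.injEq, Prod.mk.injEq, decide_eq_decide, Subtype.mk.injEq] at hab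
          refine hsuff ?_ hab.2
          have key : ∀ s t : SignType, s ≠ 0 → t ≠ 0 → (s = 1 ↔ t = 1) → s = t := by decide
          exact key _ _ h.2 h'.2 hab.1
        · simp only [Sum.inl.injEq, Subtype.mk.injEq] at hab
          by_cases h0 : a 0 = b 0
          · exact hsuff h0 hab
          have k := hmem _ a ha rfl b hb (Ne.symm h0) hab
          have k1 : a 0 = 0 := by
            by_contra hne; exact h ⟨k, hne⟩
          have k2 : b 0 = 0 := by
            by_contra hne; exact h' ⟨hab ▸ k, hne⟩
          exact absurd (k1.trans k2.symm) h0
      have := Nat.card_le_card_of_injective φ hφ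
      rw [Nat.card_sum, Nat.card_prod, Nat.card_eq_fintype_card (α := Bool), Fintype.card_bool] at this
      exact this
    have hrank : Module.finrank ℝ (LinearMap.ker (f 0)) + 1 = Module.finrank ℝ V := by
      have := Module.Dual.finrank_ker_add_one_of_ne_zero hf
      exact this
    rw [← hrank] at h₁ ⊢
    set r := Module.finrank ℝ (LinearMap.ker (f 0))
    calc R.ncard ≤ (2 * N + 1) ^ (r + 1) + 2 * (2 * N + 1) ^ r := by omega
      _ = (2 * N + 1) ^ r * (2 * (N + 1) + 1) := by ring
      _ ≤ (2 * (N + 1) + 1) ^ r * (2 * (N + 1) + 1) :=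
        Nat.mul_le_mul_right _ (Nat.pow_le_pow_left (by omega) _)
      _ = _ := by ring

/-- Representatives of the sign patterns of finitely many linear forms. -/
lemma exists_finset_representatives {n : ℕ} (Q : Finset (Fin n → ℝ)) :
    ∃ X : Finset (Fin n → ℝ), X.Nonempty ∧ X.card ≤ (2 * Q.card + 1) ^ n ∧
      ∀ y, ∃ x ∈ X, ∀ q ∈ Q, SignType.sign (q ⬝ᵥ y) = SignType.sign (q ⬝ᵥ x) := by
  let f : Fin Q.card → Module.Dual ℝ (Fin n → ℝ) := fun i =>
    dotProductBilin ℝ ℝ (Q.equivFin.symm i : Fin n → ℝ)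
  have hb := ncard_range_sign_le f
  rw [Module.finrank_fin_fun] at hb
  set g : (Fin n → ℝ) → (Fin Q.card → SignType) := fun v i => SignType.sign (f i v) with hg
  have hcard : (Set.range g).toFinset.card ≤ (2 * Q.card + 1) ^ n := by
    rwa [Set.ncard_eq_toFinset_card'] at hb
  refine ⟨(Set.range g).toFinset.image (Function.invFun g), ?_,
    Finset.card_image_le.trans hcard, fun y => ⟨Function.invFun g (g y), ?_, fun q hq => ?_⟩⟩
  · exact ⟨Function.invFun g (g 0), Finset.mem_image_of_mem _ (by simp)⟩
  · exact Finset.mem_image_of_mem _ (by simp)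
  · have h1 : g (Function.invFun g (g y)) = g y := Function.invFun_eq ⟨y, rfl⟩
    have h2 := congrFun h1 (Q.equivFin ⟨q, hq⟩)
    simpa [hg, f] using h2.symm

end LinearDecisionTree
end

/-! ### Derandomized sampling and assembly of the tree -/

noncomputable section
namespace LinearDecisionTree
open scoped Classical

variable {n : ℕ}

/-- Inserting `r` more elements of `K`, always chosen among those not yet inferred, either infers
half of `K` or reduces the set of candidate points as prescribed by `extensionCount`. -/
lemma solvable_of_extension {H : Set (Fin n → ℝ)} {K X₀ : Finset (Fin n → ℝ)}
    (hKH : ∀ u ∈ K, u ∈ H) {E : ℝ} (hE : 0 ≤ E)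
    (good : ∀ X ⊆ X₀, X.Nonempty →
      2 * (K.filter fun u => ∃ x ∈ X, ∃ y ∈ X,
        SignType.sign (u ⬝ᵥ x) ≠ SignType.sign (u ⬝ᵥ y)).card ≤ K.card →
      Solvable H X (E + 2 * Real.logb 2 X.card))
    (r : ℕ) (S : Finset (Fin n → ℝ)) (hS : S ⊆ K) (X : Finset (Fin n → ℝ)) (hX₀ : X ⊆ X₀)
    (hX : X.Nonempty) (hord : ∀ x ∈ X, ∀ y ∈ X, SameOrder S x y)
    (bad : ∀ X' ⊆ X, X'.Nonempty →
      X'.card * K.card ^ r ≤ 2 ^ r * ∑ x ∈ X, extensionCount K x r S →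
      Solvable H X' (E + 2 * Real.logb 2 X'.card)) :
    Solvable H X (E + 2 * r + 2 * Real.logb 2 X.card) := by
  induction r generalizing S X with
  | zero => simpa using bad X subset_rfl hX (by simp [extensionCount])
  | succ r ih =>
    obtain ⟨x₀, hx₀⟩ := id hX
    set U := K.filter fun u => ¬ Infers S x₀ u with hU
    have hUx : ∀ x ∈ X, (K.filter fun u => ¬ Infers S x u) = U := fun x hx =>
      Finset.filter_congr fun u _ => not_congr
        ⟨fun h => h.congr (hord x hx x₀ hx₀), fun h => h.congr (hord x₀ hx₀ x hx)⟩
    by_cases hhalf : 2 * U.card ≤ K.card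
    · refine (good X hX₀ hX (le_trans (Nat.mul_le_mul_left 2 (Finset.card_le_card ?_)) hhalf)).mono
        (by push_cast; nlinarith [r.cast_nonneg (α := ℝ)])
      intro u hu
      obtain ⟨huK, x, hx, y, hy, hxy⟩ := Finset.mem_filter.1 hu
      refine Finset.mem_filter.2 ⟨huK, fun hi => hxy ?_⟩
      exact (hi x (hord x₀ hx₀ x hx)).trans (hi y (hord x₀ hx₀ y hy)).symm
    · push Not at hhalf
      have hsum : ∑ x ∈ X, extensionCount K x (r + 1) S =
          ∑ u ∈ U, ∑ x ∈ X, extensionCount K x r (insert u S) := by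
        rw [Finset.sum_comm]
        exact Finset.sum_congr rfl fun x hx => by rw [extensionCount, hUx x hx]
      have hUne : U.Nonempty := Finset.card_pos.1 (by omega)
      -- Conditional expectations: the minimum is at most the average over `U`. Since `U` is more
      -- than half of `K`, this costs only a factor `2` against averaging over `K`.
      obtain ⟨u, huU, hmin⟩ := U.exists_min_image
        (fun u => ∑ x ∈ X, extensionCount K x r (insert u S)) hUne
      have huK : u ∈ K := (Finset.mem_filter.1 huU).1
      have hle : K.card * ∑ x ∈ X, extensionCount K x r (insert u S) ≤
          2 * ∑ x ∈ X, extensionCount K x (r + 1) S := by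
        have := Finset.card_nsmul_le_sum U _ _ hmin
        rw [smul_eq_mul, ← hsum] at this
        refine (Nat.mul_le_mul_right _ hhalf.le).trans ?_
        rw [mul_assoc]
        exact Nat.mul_le_mul_left 2 this
      have hres : E + 2 * ((r + 1 : ℕ) : ℝ) + 2 * Real.logb 2 X.card =
          (E + 2 * r) + 2 + 2 * Real.logb 2 X.card := by push_cast; ring
      rw [hres]
      refine solvable_of_insert (hKH u huK) (fun s hs => hKH s (hS hs)) (by positivity) X hX hord
        fun X' hX' hne hord' => ?_
      refine ih (insert u S) (Finset.insert_subset huK hS) X' (hX'.trans hX₀) hne hord'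
        fun X'' hX'' hne' hcard => bad X'' (hX''.trans hX') hne' ?_
      have hsub : ∑ x ∈ X', extensionCount K x r (insert u S) ≤
          ∑ x ∈ X, extensionCount K x r (insert u S) := Finset.sum_le_sum_of_subset hX'
      calc X''.card * K.card ^ (r + 1) = X''.card * K.card ^ r * K.card := by ring
        _ ≤ 2 ^ r * (∑ x ∈ X, extensionCount K x r (insert u S)) * K.card :=
          Nat.mul_le_mul_right _ (hcard.trans (Nat.mul_le_mul_left _ hsub))
        _ = 2 ^ r * (K.card * ∑ x ∈ X, extensionCount K x r (insert u S)) := by ring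
        _ ≤ 2 ^ r * (2 * ∑ x ∈ X, extensionCount K x (r + 1) S) := Nat.mul_le_mul_left _ hle
        _ = _ := by ring

/-- `m ^ m / m!` is one term of the exponential series of `e ^ m`, and `e < 3`. -/
lemma pow_self_le_three_pow_mul_factorial (m : ℕ) : m ^ m ≤ 3 ^ m * m.factorial := by
  have h1 : (m : ℝ) ^ m / m.factorial ≤ Real.exp m := Real.pow_div_factorial_le_exp _ m.cast_nonneg m
  have h2 : Real.exp m ≤ 3 ^ m := by
    rw [← mul_one (m : ℝ), Real.exp_nat_mul]
    exact pow_le_pow_left₀ (Real.exp_pos _).le (by linarith [Real.exp_one_lt_d9]) _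
  rw [div_le_iff₀ (by positivity)] at h1
  have h3 : (m : ℝ) ^ m ≤ 3 ^ m * m.factorial :=
    h1.trans (mul_le_mul_of_nonneg_right h2 (by positivity))
  exact_mod_cast h3

/-- Locating the points of `X` among the forms of `H` with bounded inference dimension. -/
lemma solvable_of_card_lt {H : Finset (Fin n → ℝ)} {d m : ℕ} (hd : 0 < d) (hm : m = 12 * d)
    (hH : ∀ S ⊆ H, ∀ x, (S.filter fun h => ¬ Infers (S.erase h) x h).card ≤ d) (j : ℕ)
    (X : Finset (Fin n → ℝ)) (hX : X.Nonempty)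
    (hj : (H.filter fun u => ∃ x ∈ X, ∃ y ∈ X,
        SignType.sign (u ⬝ᵥ x) ≠ SignType.sign (u ⬝ᵥ y)).card < 2 ^ j) :
    Solvable (H : Set (Fin n → ℝ)) X (2 * m * j + 4 * Real.logb 2 X.card) := by
  induction hc : X.card using Nat.strong_induction_on generalizing j X with
  | _ N ih =>
  subst hc
  have lognn : 0 ≤ Real.logb 2 X.card :=
    Real.logb_nonneg (by norm_num) (by exact_mod_cast hX.card_pos)
  induction j generalizing X with
  | zero =>
    refine solvable_of_forall_eq (by positivity) fun x hx y hy => ?_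
    rw [pow_zero, Nat.lt_one_iff, Finset.card_eq_zero, Finset.filter_eq_empty_iff] at hj
    funext h
    by_contra hne
    refine hj h.2 ⟨x, hx, y, hy, ?_⟩
    simpa [pointLocation, dotProduct_comm] using hne
  | succ j ihj =>
    set K := H.filter fun u => ∃ x ∈ X, ∃ y ∈ X,
        SignType.sign (u ⬝ᵥ x) ≠ SignType.sign (u ⬝ᵥ y) with hK
    have hKH : K ⊆ H := Finset.filter_subset _ _
    have hKmono : ∀ X' ⊆ X, (H.filter fun u => ∃ x ∈ X', ∃ y ∈ X',
        SignType.sign (u ⬝ᵥ x) ≠ SignType.sign (u ⬝ᵥ y)) ⊆ K := by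
      intro X' hX' u hu
      obtain ⟨huH, x, hx, y, hy, hxy⟩ := Finset.mem_filter.1 hu
      exact Finset.mem_filter.2 ⟨huH, x, hX' hx, y, hX' hy, hxy⟩
    have logmono : ∀ X' ⊆ X, X'.Nonempty → Real.logb 2 X'.card ≤ Real.logb 2 X.card := by
      intro X' h h'
      exact Real.logb_le_logb_of_le (by norm_num) (by exact_mod_cast h'.card_pos)
        (by exact_mod_cast Finset.card_le_card h)
    rcases K.eq_empty_or_nonempty with hKe | hKn
    · refine (ihj X hX ?_ ih lognn).mono (by push_cast; nlinarith [m.cast_nonneg (α := ℝ)])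
      rw [← hK, hKe]; simp
    have hKp := hKn.card_pos
    -- Half of `4 log |X|` pays for the binary searches. The other half pays the `2 m` for a round
    -- that shrinks `X` without decreasing `j`.
    have hres : 2 * (m : ℝ) * ((j + 1 : ℕ) : ℝ) + 4 * Real.logb 2 X.card =
        (2 * m * j + 2 * Real.logb 2 X.card) + 2 * m + 2 * Real.logb 2 X.card := by
      push_cast; ring
    rw [hres]
    refine solvable_of_extension (K := K) (X₀ := X) (fun u hu => hKH hu) (by positivity) ?_ m ∅
      (Finset.empty_subset _) X subset_rfl hX (fun x _ y _ s hs t ht => ?_) ?_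
    · intro X' hX' hne hhalf
      have hlt : (H.filter fun u => ∃ x ∈ X', ∃ y ∈ X',
          SignType.sign (u ⬝ᵥ x) ≠ SignType.sign (u ⬝ᵥ y)).card < 2 ^ j := by
        refine lt_of_le_of_lt (Finset.card_le_card
          (t := K.filter fun u => ∃ x ∈ X', ∃ y ∈ X',
            SignType.sign (u ⬝ᵥ x) ≠ SignType.sign (u ⬝ᵥ y)) fun u hu => ?_)
          (by rw [pow_succ] at hj; omega)
        exact Finset.mem_filter.2 ⟨hKmono X' hX' hu, (Finset.mem_filter.1 hu).2⟩
      have hl := logmono X' hX' hne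
      -- If `X` did not shrink, only the induction on `j` applies.
      rcases (Finset.card_le_card hX').lt_or_eq with hlt' | heq
      · exact (ih _ hlt' j X' hne hlt rfl).mono (by linarith)
      · have := Finset.eq_of_subset_of_card_le hX' heq.ge
        subst this
        exact (ihj X' hne hlt ih lognn).mono (by linarith)
    · simp only [insert_empty_eq, Finset.mem_singleton] at hs ht
      subst hs ht
      simp
    · intro X' hX' hne hcard
      have hsum : (∑ x ∈ X, extensionCount K x m ∅) * m.factorial ≤
          X.card * (K.card * d) ^ m := by
        rw [Finset.sum_mul, ← smul_eq_mul (X.card)]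
        exact Finset.sum_le_card_nsmul _ _ _ fun x _ =>
          extensionCount_empty_le (fun S hS => hH S (hS.trans hKH) x) m
      have hmm := pow_self_le_three_pow_mul_factorial m
      -- Bad sequences have density at most `d ^ m / m! ≤ (3 d / m) ^ m = 4 ^ (-m)`, by the choice
      -- `m = 12 d`. The greedy choices lose `2 ^ m`, leaving `2 ^ (-m)`.
      have hbound : X'.card * 2 ^ m ≤ X.card := by
        have hpos : 0 < (6 * d) ^ m * K.card ^ m * m.factorial := by positivity
        refine Nat.le_of_mul_le_mul_right ?_ hpos
        calc X'.card * 2 ^ m * ((6 * d) ^ m * K.card ^ m * m.factorial)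
            = X'.card * K.card ^ m * (m ^ m * m.factorial) := by
              have : m ^ m = 2 ^ m * (6 * d) ^ m := by
                rw [← mul_pow]; congr 1; omega
              rw [this]; ring
          _ ≤ (2 ^ m * ∑ x ∈ X, extensionCount K x m ∅) * (m ^ m * m.factorial) :=
              Nat.mul_le_mul_right _ hcard
          _ = 2 ^ m * m ^ m * ((∑ x ∈ X, extensionCount K x m ∅) * m.factorial) := by ring
          _ ≤ 2 ^ m * m ^ m * (X.card * (K.card * d) ^ m) := Nat.mul_le_mul_left _ hsum
          _ ≤ 2 ^ m * (3 ^ m * m.factorial) * (X.card * (K.card * d) ^ m) :=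
              Nat.mul_le_mul_right _ (Nat.mul_le_mul_left _ hmm)
          _ = X.card * ((6 * d) ^ m * K.card ^ m * m.factorial) := by
              have : 6 * d = 2 * 3 * d := by ring
              rw [this, mul_pow, mul_pow, mul_pow]; ring
      have hmp : 0 < m := by omega
      have hXp := hne.card_pos
      have hlt : X'.card < X.card := by
        have : 2 ≤ 2 ^ m := Nat.le_self_pow (by omega) 2
        nlinarith
      have hlog : Real.logb 2 X'.card + m ≤ Real.logb 2 X.card := by
        have h1 : Real.logb 2 (X'.card * 2 ^ m) ≤ Real.logb 2 X.card :=
          Real.logb_le_logb_of_le (by norm_num) (by positivity) (by exact_mod_cast hbound)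
        rwa [Real.logb_mul (by positivity) (by positivity), Real.logb_pow,
          Real.logb_self_eq_one (by norm_num), mul_one] at h1
      refine (ih _ hlt (j + 1) X' hne
        (lt_of_le_of_lt (Finset.card_le_card (hKmono X' hX')) hj) rfl).mono ?_
      push_cast
      linarith

/-- This carries correctness from the finitely many representatives to all inputs. -/
lemma comparisonTree_eval_congr {α : Type*} {H : Set (Fin n → ℝ)} {x y : Fin n → ℝ}
    (hl : ∀ q ∈ H, SignType.sign (q ⬝ᵥ x) = SignType.sign (q ⬝ᵥ y))
    (hc : ∀ q ∈ H, ∀ q' ∈ H, SignType.sign ((q - q') ⬝ᵥ x) = SignType.sign ((q - q') ⬝ᵥ y))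
    (T : LinearDecisionTree n α) (hT : T.IsComparisonTree H) : T.eval x = T.eval y := by
  induction T with
  | leaf a => rfl
  | query q child ih =>
    have hq : SignType.sign (q ⬝ᵥ x) = SignType.sign (q ⬝ᵥ y) := by
      rcases hT q (by simp [queries]) with h | ⟨h', hh', h'', hh'', rfl⟩
      · exact hl q h
      · exact hc h' hh' h'' hh''
    rw [eval, eval, hq]
    refine ih _ fun p hp => hT p ?_
    simp only [queries, Set.singleton_union, Set.mem_insert_iff, Set.mem_iUnion]
    exact Or.inr ⟨_, hp⟩

/-- A comparison tree for a set of fewer than `2 ^ j` many `0/1`-vectors. -/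
lemma exists_comparisonTree {H : Finset (Fin n → ℝ)} {W : Set (Fin n → ℝ)}
    (hW : (H : Set (Fin n → ℝ)) = W) {d j : ℕ} (hd0 : 0 < d)
    (hd : (2 * d + 1) ^ n < 2 ^ d) (h01 : ∀ h ∈ H, ∀ i, h i = 0 ∨ h i = 1)
    (hj : H.card < 2 ^ j) :
    ∃ T : LinearDecisionTree n (W → SignType), T.IsComparisonTree W ∧
      (T.depth : ℝ) ≤ 72 * d * j + 4 * (n * (2 * j + 2)) ∧
      ∀ x, T.eval x = pointLocation W x := by
  subst hW
  set Q := H ∪ (H ×ˢ H).image fun p => p.1 - p.2 with hQ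
  obtain ⟨X, hX, hXc, hrep⟩ := exists_finset_representatives Q
  obtain ⟨T, h1, h2, h3⟩ := solvable_of_card_lt (H := H) (d := 3 * d) (by omega) rfl
    (fun S hS x => card_filter_not_infers_le hd (fun h hh => h01 h (hS hh)) x) j X hX
    (lt_of_le_of_lt (Finset.card_le_card (Finset.filter_subset _ _)) hj)
  refine ⟨T, h1, h2.trans ?_, fun y => ?_⟩
  -- There are at most `|H| + |H|²` labels and comparisons, and `|H| < 2 ^ j`.
  · have hQc : 2 * Q.card + 1 ≤ 2 ^ (2 * j + 2) := by
      have e1 := Finset.card_union_le H ((H ×ˢ H).image fun p => p.1 - p.2)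
      have e2 := Finset.card_image_le (s := H ×ˢ H) (f := fun p => p.1 - p.2)
      rw [Finset.card_product] at e2
      have e3 : (2 : ℕ) ^ (2 * j + 2) = 4 * (2 ^ j * 2 ^ j) := by ring
      rw [e3]
      nlinarith
    have hXb : X.card ≤ 2 ^ (n * (2 * j + 2)) := by
      refine hXc.trans ((Nat.pow_le_pow_left hQc n).trans (le_of_eq ?_))
      rw [← pow_mul, mul_comm]
    have hlog : Real.logb 2 X.card ≤ n * (2 * j + 2) := by
      have h1 : Real.logb 2 X.card ≤ Real.logb 2 ((2 : ℝ) ^ (n * (2 * j + 2))) :=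
        Real.logb_le_logb_of_le (by norm_num) (by exact_mod_cast hX.card_pos)
          (by exact_mod_cast hXb)
      rw [Real.logb_pow, Real.logb_self_eq_one (by norm_num), mul_one] at h1
      exact_mod_cast h1
    push_cast
    linarith
  · obtain ⟨x, hx, hq⟩ := hrep y
    have hl : ∀ q ∈ (H : Set (Fin n → ℝ)), SignType.sign (q ⬝ᵥ y) = SignType.sign (q ⬝ᵥ x) :=
      fun q hqH => hq q (Finset.mem_union_left _ hqH)
    rw [comparisonTree_eval_congr hl (fun q hqH q' hqH' => hq _ (Finset.mem_union_right _
      (Finset.mem_image.2 ⟨(q, q'), Finset.mem_product.2 ⟨hqH, hqH'⟩, rfl⟩))) T h1, h3 x hx]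
    funext h
    simpa [pointLocation, dotProduct_comm] using (hl h h.2).symm

end LinearDecisionTree
end

/-! ### Vectors of weight `k` and the explicit constants -/

namespace LinearDecisionTree

lemma mem_weightVectors_iff {n k : ℕ} {h : Fin n → ℝ} :
    h ∈ weightVectors n k ↔
      ∃ I : Finset (Fin n), I.card = k ∧ h = fun i => if i ∈ I then 1 else 0 := by
  constructor
  · rintro ⟨h1, h2⟩
    refine ⟨Finset.univ.filter fun i => h i ≠ 0, h2, funext fun i => ?_⟩
    rcases h1 i with e | e <;> simp [e]
  · rintro ⟨I, rfl, rfl⟩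
    refine ⟨fun i => ?_, by simp [hammingNorm]⟩
    dsimp only
    split_ifs <;> simp

lemma exists_finset_eq_weightVectors (n k : ℕ) :
    ∃ H : Finset (Fin n → ℝ), (H : Set (Fin n → ℝ)) = weightVectors n k ∧ H.card ≤ n ^ k := by
  classical
  refine ⟨(Finset.univ.powersetCard k).image fun (I : Finset (Fin n)) i => if i ∈ I then 1 else 0,
    ?_, ?_⟩
  · ext h
    rw [mem_weightVectors_iff]
    simp only [Finset.coe_image, Set.mem_image, Finset.mem_coe, Finset.mem_powersetCard_univ]
    exact exists_congr fun I => and_congr_right fun _ => eq_comm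
  · refine Finset.card_image_le.trans ?_
    rw [Finset.card_powersetCard, Finset.card_fin]
    exact Nat.choose_le_pow n k

lemma hasKSum_iff {n k : ℕ} (x : Fin n → ℝ) :
    HasKSum k x ↔ ∃ h, pointLocation (weightVectors n k) x h = 0 := by
  have key : ∀ I : Finset (Fin n), (x ⬝ᵥ fun i => if i ∈ I then 1 else 0) = ∑ i ∈ I, x i := by
    intro I
    simp [dotProduct]
  constructor
  · rintro ⟨I, hI, h0⟩
    refine ⟨⟨_, mem_weightVectors_iff.2 ⟨I, hI, rfl⟩⟩, ?_⟩
    rw [pointLocation, key, h0, sign_zero]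
  · rintro ⟨⟨h, hh⟩, h0⟩
    obtain ⟨I, hI, rfl⟩ := mem_weightVectors_iff.1 hh
    rw [pointLocation, key, sign_eq_zero_iff] at h0
    exact ⟨I, hI, h0⟩

lemma IsComparisonTree.isSparse {n k : ℕ} {α : Type*} {T : LinearDecisionTree n α}
    (hT : T.IsComparisonTree (weightVectors n k)) : T.IsSparse (2 * k) := by
  intro q hq
  rcases hT q hq with h | ⟨a, ha, b, hb, rfl⟩
  · rw [h.2]; omega
  · have h1 := hammingDist_triangle b 0 a
    rw [hammingDist_zero_right, hammingDist_zero_left, ha.2, hb.2] at h1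
    rw [sub_eq_neg_add, ← hammingDist_eq_hammingNorm]
    omega

lemma IsComparisonTree.coeff_mem {n k : ℕ} {α : Type*} {T : LinearDecisionTree n α}
    (hT : T.IsComparisonTree (weightVectors n k)) {q : Fin n → ℝ} (hq : q ∈ T.queries)
    (i : Fin n) : q i = -1 ∨ q i = 0 ∨ q i = 1 := by
  rcases hT q hq with h | ⟨a, ha, b, hb, rfl⟩
  · exact Or.inr (h.1 i)
  · rcases ha.1 i with e | e <;> rcases hb.1 i with e' | e' <;> simp [e, e']

lemma exists_comparisonTree_weightVectors {n k : ℕ} (hn : 2 ≤ n) :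
    ∃ T : LinearDecisionTree n (weightVectors n k → SignType),
      T.IsComparisonTree (weightVectors n k) ∧
      (T.depth : ℝ) ≤ 6000 * k * n * (Real.log n) ^ 2 ∧
      ∀ x, T.eval x = pointLocation (weightVectors n k) x := by
  rcases Nat.eq_zero_or_pos k with rfl | hk
  -- For `k = 0` the bound allows no query; the only vector is `0`, whose sign is always `0`.
  · refine ⟨leaf 0, by simp [IsComparisonTree, queries], by simp [depth], fun x => ?_⟩
    funext h
    have : (h : Fin n → ℝ) = 0 := hammingNorm_eq_zero.1 h.2.2
    simp [eval, pointLocation, this]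
  obtain ⟨H, hH, hHc⟩ := exists_finset_eq_weightVectors n k
  set L := Nat.log 2 n + 1 with hL
  have hnL : n < 2 ^ L := Nat.lt_pow_succ_log_self (by norm_num) n
  have hL2 : 2 ≤ L := by
    have : 1 ≤ Nat.log 2 n := Nat.log_pos (by norm_num) hn
    omega
  -- With `d = 8 n L`, the base is at most `2 ^ (2 L + 5)`, and `2 L + 5 < 8 L`.
  have hd : (2 * (8 * n * L) + 1) ^ n < 2 ^ (8 * n * L) := by
    have hLL : L < 2 ^ L := Nat.lt_two_pow_self
    have h1 : 2 * (8 * n * L) + 1 ≤ 2 ^ (2 * L + 5) := by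
      have e : (2 : ℕ) ^ (2 * L + 5) = 32 * (2 ^ L * 2 ^ L) := by ring
      rw [e]
      have : n * L ≤ 2 ^ L * 2 ^ L := Nat.mul_le_mul hnL.le hLL.le
      have : 0 < 2 ^ L * 2 ^ L := by positivity
      nlinarith
    refine (Nat.pow_le_pow_left h1 n).trans_lt ?_
    rw [← pow_mul]
    refine Nat.pow_lt_pow_right (by norm_num) ?_
    have : (2 * L + 5) * n < (8 * L) * n := Nat.mul_lt_mul_of_pos_right (by omega) (by omega)
    linarith
  have hj : H.card < 2 ^ (L * k) := by
    rw [pow_mul]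
    exact hHc.trans_lt (Nat.pow_lt_pow_left hnL (by omega))
  have h01 : ∀ h ∈ H, ∀ i, h i = 0 ∨ h i = 1 := by
    intro h hh
    have : h ∈ weightVectors n k := hH ▸ hh
    exact this.1
  obtain ⟨T, h1, h2, h3⟩ := exists_comparisonTree hH (d := 8 * n * L) (by positivity) hd h01 hj
  refine ⟨T, h1, h2.trans ?_, h3⟩
  have hlogn : Real.log 2 ≤ Real.log n := Real.log_le_log (by norm_num) (by exact_mod_cast hn)
  -- For `n ≥ 2` the added `1` is at most `logb 2 n`, so `L ≤ 2 logb 2 n`, and `2 / log 2 < 3`.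
  have hLlog : (L : ℝ) ≤ 3 * Real.log n := by
    have e1 : (Nat.log 2 n : ℝ) ≤ Real.logb 2 n := by exact_mod_cast Real.natLog_le_logb n 2
    have e2 : Real.logb 2 n * Real.log 2 = Real.log n := by
      rw [Real.logb, div_mul_cancel₀ _ (Real.log_pos (by norm_num)).ne']
    have e3 : 1 ≤ Real.logb 2 n := by
      rw [Real.logb, le_div_iff₀ (Real.log_pos (by norm_num)), one_mul]; exact hlogn
    rw [hL]; push_cast
    nlinarith [Real.log_two_gt_d9]
  have hLr : (2 : ℝ) ≤ L := by exact_mod_cast hL2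
  have hkr : (1 : ℝ) ≤ k := by exact_mod_cast hk
  have hnr : (0 : ℝ) ≤ n := n.cast_nonneg
  have hLk : (2 : ℝ) ≤ L * k := by nlinarith
  have hsq : (L : ℝ) ^ 2 ≤ 9 * Real.log n ^ 2 := by nlinarith
  push_cast
  calc 72 * (8 * (n : ℝ) * L) * (L * k) + 4 * (n * (2 * (L * k) + 2))
      ≤ 576 * (k * n * L ^ 2) + 12 * n * (L * k) := by nlinarith
    _ ≤ 576 * (k * n * L ^ 2) + 12 * n * (L * k) * L := by
        have : 0 ≤ 12 * (n : ℝ) * (L * k) := by positivity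
        nlinarith
    _ = 588 * (k * n) * L ^ 2 := by ring
    _ ≤ 588 * (k * n) * (9 * Real.log n ^ 2) := mul_le_mul_of_nonneg_left hsq (by positivity)
    _ ≤ 6000 * k * n * Real.log n ^ 2 := by
        have : 0 ≤ k * n * Real.log n ^ 2 := by positivity
        linarith

end LinearDecisionTree

theorem mainTheorem5 :
    ∃ C : ℝ, 0 < C ∧ ∀ n k : ℕ, 2 ≤ n →
      ∃ T : LinearDecisionTree n (weightVectors n k → SignType),
        T.IsComparisonTree (weightVectors n k) ∧
        (T.depth : ℝ) ≤ C * k * n * (Real.log n) ^ 2 ∧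
        (∀ x : Fin n → ℝ, T.eval x = pointLocation (weightVectors n k) x) ∧
        (∀ x : Fin n → ℝ, HasKSum k x ↔ ∃ h, T.eval x h = 0) ∧
        T.IsSparse (2 * k) ∧
        (∀ q ∈ T.queries, ∀ i, q i = -1 ∨ q i = 0 ∨ q i = 1) := by
  refine ⟨6000, by norm_num, fun n k hn => ?_⟩
  obtain ⟨T, h1, h2, h3⟩ := LinearDecisionTree.exists_comparisonTree_weightVectors (k := k) hn
  refine ⟨T, h1, h2, h3, fun x => ?_, h1.isSparse, fun q hq i => h1.coeff_mem hq i⟩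
  rw [h3 x]
  exact LinearDecisionTree.hasKSum_iff x
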